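/- Let $n\ge 1$ and $q\ge 1$ be integers, and let $M,K\in\mathbb{R}^{n\times n}$ be symmetric positive definite. For $i,j\in\{1,\dots,q\}$ let $D_{ij},R_{ij}\in\mathbb{R}^{n\times n}$ be symmetric positive semidefinite with $D_{ij}=D_{ji}$, $R_{ij}=R_{ji}$, $D_{ii}=R_{ii}=0$. Consider the array of $q$ coupled oscillators $$M\ddot x_i+Kx_i+\sum_{j=1}^{q}D_{ij}(\dot x_i-\dot x_j)+\sum_{j=1}^{q}R_{ij}(x_i-x_j)=0,\qquad i=1,\dots,q,$$ with $x_i(t)\in\mathbb{R}^n$. The array is said to synchronize if $\|x_i(t)-x_j(t)\|\to 0$ as $t\to\infty$ for all $i,j$ and for all solutions (that is, for all initial conditions). Put $P=M^{-1/2}KM^{-1/2}$ and assume that the eigenvalues of $P$ are distinct. For a symmetric family of symmetric positive semidefinite weights $W_{ij}\in\mathbb{R}^{n\times n}$ with $W_{ii}=0$ let $\mathrm{lap}(W_{ij})\in\mathbb{R}^{qn\times qn}$ denote the block matrix with diagonal blocks $\sum_{j}W_{ij}$ and off-diagonal blocks $-W_{ij}$, and put $$L_d=\mathrm{lap}(M^{-1/2}D_{ij}M^{-1/2}),\qquad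 L_r=\mathrm{lap}(M^{-1/2}R_{ij}M^{-1/2}),\qquad \Gamma=L_d+\mathrm{j}\,(I_q\otimes P+L_r)\in\mathbb{C}^{qn\times qn},$$ where $\mathrm{j}$ is the imaginary unit. Let $\lambda_1(\Gamma),\dots,\lambda_{qn}(\Gamma)$ be the eigenvalues of $\Gamma$, listed with algebraic multiplicity in any order such that $\mathrm{Re}\,\lambda_1(\Gamma)\le\dots\le\mathrm{Re}\,\lambda_{qn}(\Gamma)$. Then: 1. If $q\ge 2$ (so that $\lambda_{n+1}(\Gamma)$ exists), the array synchronizes if and only if $\mathrm{Re}\,\lambda_{n+1}(\Gamma)>0$. 2. The array synchronizes if and only if $\Gamma$ has exactly $n$ eigenvalues on the imaginary axis, counted with algebraic multiplicity. -/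

import Mathlib

open Filter Topology Matrix
open scoped Kronecker MatrixOrder

namespace SmallOscillations

noncomputable section

/-- The array of `q` coupled oscillators
`M ẍᵢ + K xᵢ + ∑ⱼ Dᵢⱼ (ẋᵢ - ẋⱼ) + ∑ⱼ Rᵢⱼ (xᵢ - xⱼ) = 0`, `i = 1, …, q`:
`x` is a (twice differentiable) solution of it. -/
def IsSolution {n q : ℕ} (M K : Matrix (Fin n) (Fin n) ℝ)
    (D R : Fin q → Fin q → Matrix (Fin n) (Fin n) ℝ)
    (x : Fin q → ℝ → (Fin n → ℝ)) : Prop :=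
  (∀ i, Differentiable ℝ (x i)) ∧
  (∀ i, Differentiable ℝ (deriv (x i))) ∧
  ∀ i t, M *ᵥ deriv (deriv (x i)) t + K *ᵥ x i t
    + ∑ j, D i j *ᵥ (deriv (x i) t - deriv (x j) t)
    + ∑ j, R i j *ᵥ (x i t - x j t) = 0

/-- The array synchronizes: for every solution, hence for all initial conditions,
the Euclidean norm of `xᵢ(t) - xⱼ(t)` tends to `0` as `t → ∞`, for all `i`, `j`. -/
def Synchronizes {n q : ℕ} (M K : Matrix (Fin n) (Fin n) ℝ)
    (D R : Fin q → Fin q → Matrix (Fin n) (Fin n) ℝ) : Prop :=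
  ∀ x : Fin q → ℝ → (Fin n → ℝ), IsSolution M K D R x →
    ∀ i j, Tendsto (fun t => ‖WithLp.toLp 2 (x i t - x j t)‖) atTop (𝓝 0)

/-- `M ^ (-1/2)`, the inverse of the positive semidefinite square root of `M`. -/
def invSqrt {n : ℕ} (M : Matrix (Fin n) (Fin n) ℝ) : Matrix (Fin n) (Fin n) ℝ :=
  (CFC.sqrt M)⁻¹

/-- `P = M ^ (-1/2) K M ^ (-1/2)`. -/
def matP {n : ℕ} (M K : Matrix (Fin n) (Fin n) ℝ) : Matrix (Fin n) (Fin n) ℝ :=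
  invSqrt M * K * invSqrt M

/-- The matrix-weighted Laplacian: the block matrix with diagonal blocks `∑ⱼ Wᵢⱼ`
and off-diagonal blocks `-Wᵢⱼ`. -/
def lap {n q : ℕ} (W : Fin q → Fin q → Matrix (Fin n) (Fin n) ℝ) :
    Matrix (Fin q × Fin n) (Fin q × Fin n) ℝ :=
  Matrix.of fun a b =>
    if a.1 = b.1 then (∑ j, W a.1 j) a.2 b.2 else -(W a.1 b.1 a.2 b.2)

/-- The Laplacian of the coupling `W` in the coordinates `zᵢ = M ^ (1/2) xᵢ`. -/
def couplingLap {n q : ℕ} (M : Matrix (Fin n) (Fin n) ℝ)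
    (W : Fin q → Fin q → Matrix (Fin n) (Fin n) ℝ) :
    Matrix (Fin q × Fin n) (Fin q × Fin n) ℝ :=
  lap fun i j => invSqrt M * W i j * invSqrt M

/-- `Γ = L_d + j (I_q ⊗ P + L_r)`, where `j` is the imaginary unit. -/
def matGamma {n q : ℕ} (M K : Matrix (Fin n) (Fin n) ℝ)
    (D R : Fin q → Fin q → Matrix (Fin n) (Fin n) ℝ) :
    Matrix (Fin q × Fin n) (Fin q × Fin n) ℂ :=
  (couplingLap M D).map Complex.ofReal +
    Complex.I • ((1 : Matrix (Fin q) (Fin q) ℝ) ⊗ₖ matP M K + couplingLap M R).map Complex.ofReal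

/-- `lam` lists the eigenvalues of `X`, with algebraic multiplicity, by nondecreasing real part;
`lam 0` is the first one. -/
def IsEigenvalueOrdering {ι : Type*} [Fintype ι] [DecidableEq ι] (X : Matrix ι ι ℂ)
    (lam : Fin (Fintype.card ι) → ℂ) : Prop :=
  Finset.univ.val.map lam = X.charpoly.roots ∧ Monotone fun k => (lam k).re

/-- Number of eigenvalues of `X` on the imaginary axis, with algebraic multiplicity. -/
def imagAxisCount {ι : Type*} [Fintype ι] [DecidableEq ι] (X : Matrix ι ι ℂ) : ℕ :=
  X.charpoly.roots.countP fun z => z.re = 0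

end

/-- Every complex matrix has such a listing of its eigenvalues. -/
theorem exists_isEigenvalueOrdering {ι : Type*} [Fintype ι] [DecidableEq ι] (X : Matrix ι ι ℂ) :
    ∃ lam, IsEigenvalueOrdering X lam := by
  have hc : X.charpoly.roots.toList.length = Fintype.card ι := by
    rw [Multiset.length_toList, IsAlgClosed.card_roots_eq_natDegree,
      Matrix.charpoly_natDegree_eq_dim]
  let f : Fin (Fintype.card ι) → ℂ := fun k => X.charpoly.roots.toList.get (Fin.cast hc.symm k)
  have hf : Finset.univ.val.map f = X.charpoly.roots := by
    have h1 : List.ofFn f = X.charpoly.roots.toList := by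
      apply List.ext_getElem
      · simp [hc]
      · intro i h1 h2
        simp [f]
    have h2 := congrArg (fun l : List ℂ => (l : Multiset ℂ)) h1
    simpa [Fin.univ_val_map] using h2
  refine ⟨f ∘ Tuple.sort (fun k => (f k).re), ?_, Tuple.monotone_sort (fun k => (f k).re)⟩
  rw [← hf, ← Multiset.map_map]
  congr 1
  exact congrArg Finset.val (Finset.map_univ_equiv (Tuple.sort fun k => (f k).re))

/-- For `n ≥ 1` and `q ≥ 2` a `qn × qn` matrix has an `(n+1)`-st eigenvalue. -/
theorem lt_card_prod {n q : ℕ} (hn : 1 ≤ n) (hq : 2 ≤ q) :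
    n < Fintype.card (Fin q × Fin n) := by
  simp only [Fintype.card_prod, Fintype.card_fin]
  nlinarith

end SmallOscillations

/-!
In the coordinates `zᵢ = M ^ (1/2) xᵢ` the array is one damped oscillator `z'' + L z' + A z = 0`
with damping `L = L_d` and stiffness `A = I ⊗ P + L_r`. By LaSalle's principle for the energy, its
positions approach the undamped space, the largest `A`-invariant subspace of `ker L`. This space is
spanned by eigenvectors of `A`, each of which carries a harmonic oscillation, so a linear function
of the position tends to `0` along every motion iff it vanishes on the undamped space. In
particular the array synchronizes iff the undamped space consists of synchronous vectors.

On the other hand `Γ = L + i A` satisfies `Γ + Γᴴ = 2 L ≥ 0`. Hence no eigenvalue of `Γ` has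
negative real part, the imaginary ones are semisimple, and their eigenvectors span the
complexification of the undamped space, so they are as many as its dimension. The synchronous
vectors form an `n`-dimensional subspace of the undamped space, and the two spaces agree iff their
dimensions do.
-/

namespace SmallOscillations

section Flow

/-- LaSalle's invariance principle: if `y` is a cluster point of the orbit of `x`, then so is every
`φ s y`, hence `e (φ s y) = c`. -/
theorem tendsto_nhdsSet_of_tendsto_flow {τ α β : Type*} [AddCommGroup τ] [PartialOrder τ]
    [IsOrderedAddMonoid τ] [TopologicalSpace τ] [TopologicalSpace α] [TopologicalSpace β]
    [T2Space β] (φ : Flow τ α) {x : α} {S : Set α} (hS : IsCompact S)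
    (hxS : ∀ᶠ t in atTop, φ t x ∈ S) {e : α → β} (he : Continuous e) {c : β}
    (hc : Tendsto (fun t => e (φ t x)) atTop (𝓝 c)) :
    Tendsto (fun t => φ t x) atTop (𝓝ˢ {y | ∀ s, e (φ s y) = c}) := by
  rw [tendsto_iff_ultrafilter]
  intro g hg
  obtain ⟨y, -, hy⟩ := hS.ultrafilter_le_nhds (g.map fun t => φ t x)
    (le_principal_iff.2 (hg hxS))
  refine hy.trans (nhds_le_nhdsSet fun s => ?_)
  have hshift : Tendsto (fun t => e (φ (s + t) x)) g (𝓝 c) :=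
    (hc.comp (tendsto_atTop_add_const_left atTop s tendsto_id)).mono_left hg
  simp only [φ.map_add] at hshift
  exact tendsto_nhds_unique (((he.comp (φ.continuous_toFun s)).tendsto y).comp hy) hshift

variable {F : Type*} [NormedAddCommGroup F] [NormedSpace ℝ F] [CompleteSpace F]

/-- The flow `(t, y) ↦ exp (t B) y` of the linear differential equation `y' = B y`. -/
noncomputable def linearFlow (B : F →L[ℝ] F) : Flow ℝ F where
  toFun t y := NormedSpace.exp (t • B) y
  cont' := by
    let : NormedAlgebra ℚ (F →L[ℝ] F) := .restrictScalars ℚ ℝ _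
    exact (NormedSpace.exp_continuous.comp (continuous_fst.smul continuous_const)).clm_apply
      continuous_snd
  map_add' s t y := by
    let : NormedAlgebra ℚ (F →L[ℝ] F) := .restrictScalars ℚ ℝ _
    rw [add_smul, NormedSpace.exp_add_of_commute (((Commute.refl B).smul_left s).smul_right t),
      mul_apply_eq_comp]
  map_zero' y := by simp

theorem hasDerivAt_linearFlow (B : F →L[ℝ] F) (y : F) (t : ℝ) :
    HasDerivAt (fun s => linearFlow B s y) (B (linearFlow B t y)) t := by
  simpa [linearFlow] using (hasDerivAt_exp_smul_const' B t).clm_apply (hasDerivAt_const t y)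

theorem eq_linearFlow {B : F →L[ℝ] F} {y : ℝ → F} (hy : ∀ t, HasDerivAt y (B (y t)) t) :
    y = fun t => linearFlow B t (y 0) :=
  ODE_solution_unique_univ (v := fun _ => B) (s := fun _ => Set.univ) (t₀ := 0)
    (fun _ => B.lipschitz.lipschitzOnWith) (fun t => ⟨hy t, trivial⟩)
    (fun t => ⟨hasDerivAt_linearFlow B (y 0) t, trivial⟩) (by simp)

end Flow

theorem exists_pos_mul_norm_sq_le {F : Type*} [NormedAddCommGroup F] [NormedSpace ℝ F]
    [FiniteDimensional ℝ F] {e : F → ℝ} (he : Continuous e)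
    (hsmul : ∀ (a : ℝ) y, e (a • y) = a ^ 2 * e y) (hpos : ∀ y, y ≠ 0 → 0 < e y) :
    ∃ m, 0 < m ∧ ∀ y, m * ‖y‖ ^ 2 ≤ e y := by
  have he0 : e 0 = 0 := by simpa using hsmul 0 0
  have hproper : ProperSpace F := FiniteDimensional.proper_real F
  rcases subsingleton_or_nontrivial F with hF | hF
  · exact ⟨1, one_pos, fun y => by simp [Subsingleton.elim y 0, he0]⟩
  obtain ⟨u, hu, hmin⟩ := (isCompact_sphere (0 : F) 1).exists_isMinOn
    (NormedSpace.sphere_nonempty.2 zero_le_one) he.continuousOn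
  refine ⟨e u, hpos u (by rintro rfl; simp at hu), fun y => ?_⟩
  rcases eq_or_ne y 0 with rfl | hy
  · simp [he0]
  have hscaled : e u ≤ e (‖y‖⁻¹ • y) := hmin (by simp [norm_smul, hy])
  rwa [hsmul, inv_pow, inv_mul_eq_div, le_div_iff₀ (by positivity)] at hscaled

section UndampedSpace

variable {R ι : Type*} [CommRing R] [Fintype ι] [DecidableEq ι]

/-- The largest `A`-invariant subspace of the kernel of `L` (in control theory, the unobservable
subspace of the pair `(L, A)`). For a damped oscillator with stiffness `A` and damping `L` it
contains the motions on which the damping never acts. -/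
def undampedSpace (A L : Matrix ι ι R) : Submodule R (ι → R) :=
  ⨅ k : ℕ, LinearMap.ker (L * A ^ k).mulVecLin

variable {A L : Matrix ι ι R}

theorem mem_undampedSpace {v : ι → R} :
    v ∈ undampedSpace A L ↔ ∀ k : ℕ, (L * A ^ k) *ᵥ v = 0 := by
  simp [undampedSpace]

theorem mulVec_eq_zero_of_mem_undampedSpace {v : ι → R} (hv : v ∈ undampedSpace A L) :
    L *ᵥ v = 0 := by
  simpa using mem_undampedSpace.1 hv 0

theorem mulVec_mem_undampedSpace {v : ι → R} (hv : v ∈ undampedSpace A L) :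
    A *ᵥ v ∈ undampedSpace A L :=
  mem_undampedSpace.2 fun k => by
    rw [mulVec_mulVec, mul_assoc, ← pow_succ]
    exact mem_undampedSpace.1 hv (k + 1)

theorem le_undampedSpace {V : Submodule R (ι → R)} (hA : ∀ v ∈ V, A *ᵥ v ∈ V)
    (hL : ∀ v ∈ V, L *ᵥ v = 0) : V ≤ undampedSpace A L := fun v hv => by
  have hpow : ∀ k : ℕ, A ^ k *ᵥ v ∈ V := fun k => by
    induction k with
    | zero => simpa
    | succ k ih =>
      rw [pow_succ', ← mulVec_mulVec]
      exact hA _ ih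
  exact mem_undampedSpace.2 fun k => by rw [← mulVec_mulVec, hL _ (hpow k)]

theorem mem_undampedSpace_of_mulVec_eq_smul {v : ι → R} {μ : R} (hA : A *ᵥ v = μ • v)
    (hL : L *ᵥ v = 0) : v ∈ undampedSpace A L := by
  refine le_undampedSpace (V := R ∙ v) (fun w hw => ?_) (fun w hw => ?_)
    (Submodule.mem_span_singleton_self v) <;>
  obtain ⟨a, rfl⟩ := Submodule.mem_span_singleton.1 hw
  · rw [mulVec_smul, hA]
    exact Submodule.smul_mem _ _ (Submodule.smul_mem _ _ (Submodule.mem_span_singleton_self v))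
  · rw [mulVec_smul, hL, smul_zero]

theorem mem_of_apply_mem_of_injective {K V : Type*} [DivisionRing K] [AddCommGroup V] [Module K V]
    {f : Module.End K V} (hf : Function.Injective f) {W : Submodule K V} [FiniteDimensional K W]
    (hW : ∀ w ∈ W, f w ∈ W) {x : V} (hx : f x ∈ W) : x ∈ W := by
  have hmap : W.map f = W := Submodule.eq_of_le_of_finrank_eq (Submodule.map_le_iff_le_comap.2 hW)
    (Submodule.equivMapOfInjective f hf W).finrank_eq.symm
  rw [← hmap] at hx
  obtain ⟨w, hw, hwx⟩ := hx
  exact hf hwx ▸ hw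

end UndampedSpace

section Hermitian

variable {𝕜 ι : Type*} [RCLike 𝕜] [Fintype ι] {A : Matrix ι ι 𝕜}

theorem iSup_eigenspace_toLin'_eq_top [DecidableEq ι] (hA : A.IsHermitian) :
    ⨆ μ : 𝕜, Module.End.eigenspace (toLin' A) μ = ⊤ := by
  let b := hA.eigenvectorBasis.toBasis.map (WithLp.linearEquiv 2 𝕜 (ι → 𝕜))
  rw [eq_top_iff, ← b.span_eq, Submodule.span_le]
  rintro _ ⟨i, rfl⟩
  refine Submodule.mem_iSup_of_mem (hA.eigenvalues i : 𝕜) (Module.End.mem_eigenspace_iff.2 ?_)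
  change A *ᵥ (hA.eigenvectorBasis.toBasis i).ofLp = (hA.eigenvalues i : 𝕜) • _
  rw [OrthonormalBasis.coe_toBasis, hA.mulVec_eigenvectorBasis]
  exact RCLike.real_smul_eq_coe_smul _ _

open scoped ComplexOrder in
theorem coe_re_eq_of_mulVec_eq_smul (hA : A.IsHermitian) {v : ι → 𝕜} (hv : v ≠ 0) {μ : 𝕜}
    (h : A *ᵥ v = μ • v) : (RCLike.re μ : 𝕜) = μ := by
  have him := hA.im_star_dotProduct_mulVec_self v
  obtain ⟨hre, hzero⟩ := RCLike.pos_iff.1 (dotProduct_star_self_pos_iff.2 hv)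
  rw [h, dotProduct_smul, smul_eq_mul, RCLike.mul_im, hzero, mul_zero, zero_add] at him
  have hμ : RCLike.im μ = 0 := (mul_eq_zero.1 him).resolve_right hre.ne'
  exact RCLike.conj_eq_iff_re.1 (RCLike.conj_eq_iff_im.2 hμ)

theorem le_of_forall_eigenvector_mem (hA : A.IsHermitian) {V U : Submodule 𝕜 (ι → 𝕜)}
    (hV : ∀ v ∈ V, A *ᵥ v ∈ V) (hU : ∀ v ∈ V, ∀ μ : ℝ, A *ᵥ v = (μ : 𝕜) • v → v ∈ U) : V ≤ U := by
  classical
  rw [Submodule.eq_iSup_inf_genEigenspace (f := toLin' A) 1 hV (iSup_eigenspace_toLin'_eq_top hA)]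
  refine iSup_le fun μ v ⟨hvV, hvμ⟩ => ?_
  rcases eq_or_ne v 0 with rfl | hv
  · exact U.zero_mem
  have hAv : A *ᵥ v = μ • v := Module.End.mem_eigenspace_iff.1 hvμ
  exact hU v hvV (RCLike.re μ) (by rw [coe_re_eq_of_mulVec_eq_smul hA hv hAv, hAv])

end Hermitian

section DampedMotion

variable {ι : Type*} [Fintype ι] {A L : Matrix ι ι ℝ} {z v : ℝ → ι → ℝ}

/-- The curve `z` with velocity `v` is a motion of the damped oscillator `z'' + L z' + A z = 0`. -/
structure IsDampedMotion (A L : Matrix ι ι ℝ) (z v : ℝ → ι → ℝ) : Prop where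
  position : ∀ t, HasDerivAt z (v t) t
  velocity : ∀ t, HasDerivAt v (-(A *ᵥ z t) - L *ᵥ v t) t

/-- The generator of the damped oscillator on its phase space of pairs (position, velocity). -/
noncomputable def oscillatorGenerator (A L : Matrix ι ι ℝ) :
    (ι → ℝ) × (ι → ℝ) →L[ℝ] (ι → ℝ) × (ι → ℝ) :=
  LinearMap.toContinuousLinearMap <|
    (LinearMap.snd ℝ _ _).prod
      (-(A.mulVecLin ∘ₗ LinearMap.fst ℝ _ _) - L.mulVecLin ∘ₗ LinearMap.snd ℝ _ _)

/-- Twice the energy of an oscillator with stiffness `A` in the phase space point `y`. -/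
def oscillatorEnergy (A : Matrix ι ι ℝ) (y : (ι → ℝ) × (ι → ℝ)) : ℝ :=
  y.2 ⬝ᵥ y.2 + y.1 ⬝ᵥ (A *ᵥ y.1)

theorem IsDampedMotion.hasDerivAt (h : IsDampedMotion A L z v) (t : ℝ) :
    HasDerivAt (fun s => (z s, v s)) (oscillatorGenerator A L (z t, v t)) t :=
  (h.position t).prodMk (h.velocity t)

theorem isDampedMotion_linearFlow (A L : Matrix ι ι ℝ) (y : (ι → ℝ) × (ι → ℝ)) :
    IsDampedMotion A L (fun t => (linearFlow (oscillatorGenerator A L) t y).1)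
      fun t => (linearFlow (oscillatorGenerator A L) t y).2 where
  position t := (hasDerivAt_linearFlow (oscillatorGenerator A L) y t).fst
  velocity t := (hasDerivAt_linearFlow (oscillatorGenerator A L) y t).snd

theorem hasDerivAt_mulVec {κ : Type*} [Finite κ] (B : Matrix κ ι ℝ) {u : ℝ → ι → ℝ} {u' : ι → ℝ}
    {t : ℝ} (hu : HasDerivAt u u' t) : HasDerivAt (fun s => B *ᵥ u s) (B *ᵥ u') t := by
  have := Fintype.ofFinite κ
  exact (LinearMap.toContinuousLinearMap B.mulVecLin).hasFDerivAt.comp_hasDerivAt t hu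

theorem mulVec_eq_zero_of_hasDerivAt {κ : Type*} [Finite κ] {B : Matrix κ ι ℝ} {u : ℝ → ι → ℝ}
    (hB : ∀ t, B *ᵥ u t = 0) {u' : ι → ℝ} {t : ℝ} (hu : HasDerivAt u u' t) : B *ᵥ u' = 0 := by
  have := Fintype.ofFinite κ
  have hderiv := hasDerivAt_mulVec B hu
  simp only [hB] at hderiv
  exact hderiv.unique (hasDerivAt_const t 0)

theorem hasDerivAt_dotProduct {u w : ℝ → ι → ℝ} {u' w' : ι → ℝ} {t : ℝ} (hu : HasDerivAt u u' t)
    (hw : HasDerivAt w w' t) :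
    HasDerivAt (fun s => u s ⬝ᵥ w s) (u' ⬝ᵥ w t + u t ⬝ᵥ w') t :=
  (HasDerivAt.fun_sum fun i _ => (hasDerivAt_pi.1 hu i).mul (hasDerivAt_pi.1 hw i)).congr_deriv
    Finset.sum_add_distrib

theorem continuous_oscillatorEnergy (A : Matrix ι ι ℝ) : Continuous (oscillatorEnergy A) :=
  (continuous_snd.dotProduct continuous_snd).add
    (continuous_fst.dotProduct (continuous_const.matrix_mulVec continuous_fst))

theorem oscillatorEnergy_smul (A : Matrix ι ι ℝ) (a : ℝ) (y : (ι → ℝ) × (ι → ℝ)) :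
    oscillatorEnergy A (a • y) = a ^ 2 * oscillatorEnergy A y := by
  simp only [oscillatorEnergy, Prod.smul_fst, Prod.smul_snd, mulVec_smul, dotProduct_smul,
    smul_dotProduct, smul_eq_mul]
  ring

theorem oscillatorEnergy_pos (hA : A.PosDef) {y : (ι → ℝ) × (ι → ℝ)} (hy : y ≠ 0) :
    0 < oscillatorEnergy A y := by
  rcases eq_or_ne y.1 0 with h₁ | h₁
  · have h₂ : y.2 ≠ 0 := fun h₂ => hy (Prod.ext h₁ h₂)
    simpa [oscillatorEnergy, h₁] using dotProduct_star_self_pos_iff.2 h₂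
  · exact add_pos_of_nonneg_of_pos (by simpa using dotProduct_star_self_nonneg y.2)
      (by simpa using hA.dotProduct_mulVec_pos h₁)

theorem isCompact_setOf_oscillatorEnergy_le (hA : A.PosDef) (a : ℝ) :
    IsCompact {y | oscillatorEnergy A y ≤ a} := by
  obtain ⟨m, hm, hle⟩ := exists_pos_mul_norm_sq_le (continuous_oscillatorEnergy A)
    (oscillatorEnergy_smul A) fun _ => oscillatorEnergy_pos hA
  refine (isCompact_closedBall 0 (√(a / m))).of_isClosed_subset
    (isClosed_le (continuous_oscillatorEnergy A) continuous_const) fun y hy => ?_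
  rw [mem_closedBall_zero_iff]
  exact Real.le_sqrt_of_sq_le ((le_div_iff₀' hm).2 ((hle y).trans hy))

theorem IsDampedMotion.hasDerivAt_oscillatorEnergy (hA : A.IsHermitian)
    (h : IsDampedMotion A L z v) (t : ℝ) :
    HasDerivAt (fun s => oscillatorEnergy A (z s, v s)) (-2 * (v t ⬝ᵥ (L *ᵥ v t))) t := by
  refine ((hasDerivAt_dotProduct (h.velocity t) (h.velocity t)).add
    (hasDerivAt_dotProduct (h.position t) (hasDerivAt_mulVec A (h.position t)))).congr_deriv ?_
  have hsymm : z t ⬝ᵥ (A *ᵥ v t) = v t ⬝ᵥ (A *ᵥ z t) := by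
    rw [dotProduct_mulVec, ← mulVec_transpose, ← conjTranspose_eq_transpose_of_trivial, hA.eq,
      dotProduct_comm]
  rw [dotProduct_comm _ (v t), hsymm]
  simp only [dotProduct_sub, dotProduct_neg]
  ring

theorem IsDampedMotion.antitone_oscillatorEnergy (hA : A.IsHermitian) (hL : L.PosSemidef)
    (h : IsDampedMotion A L z v) : Antitone fun t => oscillatorEnergy A (z t, v t) :=
  antitone_of_hasDerivAt_nonpos (h.hasDerivAt_oscillatorEnergy hA) fun t =>
    mul_nonpos_of_nonpos_of_nonneg (by norm_num)
      (by simpa using hL.dotProduct_mulVec_nonneg (v t))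

theorem IsDampedMotion.mulVec_velocity_eq_zero (hA : A.IsHermitian) (hL : L.PosSemidef)
    (h : IsDampedMotion A L z v) {c : ℝ} (hc : ∀ t, oscillatorEnergy A (z t, v t) = c) (t : ℝ) :
    L *ᵥ v t = 0 := by
  have hderiv := h.hasDerivAt_oscillatorEnergy hA t
  simp only [hc] at hderiv
  rw [← hL.dotProduct_mulVec_zero_iff]
  simpa using hderiv.unique (hasDerivAt_const t c)

theorem isDampedMotion_cos_smul {u : ι → ℝ} {ω : ℝ} (hA : A *ᵥ u = ω ^ 2 • u) (hL : L *ᵥ u = 0) :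
    IsDampedMotion A L (fun t => Real.cos (ω * t) • u) fun t => (-Real.sin (ω * t) * ω) • u := by
  have hphase (t : ℝ) : HasDerivAt (fun s => ω * s) ω t := by
    simpa using (hasDerivAt_id t).const_mul ω
  refine ⟨fun t => (hphase t).cos.smul_const u, fun t => ?_⟩
  refine ((((hphase t).sin.neg).mul_const ω).smul_const u).congr_deriv ?_
  rw [mulVec_smul, mulVec_smul, hA, hL, smul_zero, sub_zero, smul_smul, ← neg_smul]
  ring_nf

variable [DecidableEq ι]

/-- Differentiating `L v = 0` repeatedly along the motion gives `L A ^ k v = 0` and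
`L A ^ (k + 1) z = 0` for all `k`; invertibility of `A` supplies the missing `L z = 0`. -/
theorem IsDampedMotion.position_mem_undampedSpace (hA : IsUnit A) (h : IsDampedMotion A L z v)
    (hL : ∀ t, L *ᵥ v t = 0) (t : ℝ) : z t ∈ undampedSpace A L := by
  have hstep : ∀ k : ℕ, (∀ s, (L * A ^ k) *ᵥ v s = 0) → ∀ s, (L * A ^ (k + 1)) *ᵥ z s = 0 :=
    fun k hk s => by
      have := mulVec_eq_zero_of_hasDerivAt hk (h.velocity s)
      rwa [hL, sub_zero, mulVec_neg, neg_eq_zero, mulVec_mulVec, mul_assoc, ← pow_succ] at this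
  have hvel : ∀ (k : ℕ) (s : ℝ), (L * A ^ k) *ᵥ v s = 0 := fun k => by
    induction k with
    | zero => simpa using hL
    | succ k ih => exact fun s => mulVec_eq_zero_of_hasDerivAt (hstep k ih) (h.position s)
  have hAz : A *ᵥ z t ∈ undampedSpace A L := mem_undampedSpace.2 fun k => by
    rw [mulVec_mulVec, mul_assoc, ← pow_succ]
    exact hstep k (hvel k) t
  exact mem_of_apply_mem_of_injective (f := A.mulVecLin) (mulVec_injective_of_isUnit hA)
    (fun _ => mulVec_mem_undampedSpace) hAz

theorem IsDampedMotion.tendsto_nhdsSet_undampedSpace (hA : A.PosDef) (hL : L.PosSemidef)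
    (h : IsDampedMotion A L z v) : Tendsto z atTop (𝓝ˢ (undampedSpace A L)) := by
  have hanti := h.antitone_oscillatorEnergy hA.1 hL
  have hnonneg : ∀ y, 0 ≤ oscillatorEnergy A y := fun y => by
    rcases eq_or_ne y 0 with rfl | hy
    · simp [oscillatorEnergy]
    · exact (oscillatorEnergy_pos hA hy).le
  have hlim := tendsto_atTop_ciInf hanti ⟨0, Set.forall_mem_range.2 fun t => hnonneg _⟩
  obtain ⟨y₀, hflow⟩ : ∃ y₀, ∀ t, (z t, v t) = linearFlow (oscillatorGenerator A L) t y₀ :=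
    ⟨_, congrFun (eq_linearFlow h.hasDerivAt)⟩
  have hbound := (eventually_ge_atTop (0 : ℝ)).mono fun t ht => hanti ht
  simp only [hflow] at hlim hbound
  have hphase := tendsto_nhdsSet_of_tendsto_flow _
    (isCompact_setOf_oscillatorEnergy_le hA _) hbound (continuous_oscillatorEnergy A) hlim
  have hfst := (continuous_fst.tendsto_nhdsSet (t := (undampedSpace A L : Set (ι → ℝ)))
    fun y hy => ?_).comp hphase
  · exact hfst.congr fun t => by rw [Function.comp_apply, ← hflow]
  · have hy' := isDampedMotion_linearFlow A L y
    have hmem := hy'.position_mem_undampedSpace hA.isUnit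
      (hy'.mulVec_velocity_eq_zero hA.1 hL hy) 0
    rwa [Flow.map_zero_apply] at hmem

theorem forall_tendsto_zero_iff_undampedSpace_le_ker (hA : A.PosDef) (hL : L.PosSemidef)
    {F : Type*} [NormedAddCommGroup F] [NormedSpace ℝ F] (f : (ι → ℝ) →ₗ[ℝ] F) :
    (∀ z v, IsDampedMotion A L z v → Tendsto (fun t => f (z t)) atTop (𝓝 0)) ↔
      undampedSpace A L ≤ LinearMap.ker f := by
  have hf : Continuous f := f.continuous_of_finiteDimensional
  refine ⟨fun h => le_of_forall_eigenvector_mem hA.1 (fun _ => mulVec_mem_undampedSpace)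
    fun u hu μ hμ => ?_, fun h z v hzv => ?_⟩
  · rcases eq_or_ne u 0 with rfl | hu0
    · exact Submodule.zero_mem _
    have hμpos : 0 < μ := by
      have hpos := hA.dotProduct_mulVec_pos hu0
      rw [hμ, dotProduct_smul] at hpos
      exact pos_of_mul_pos_left hpos (dotProduct_star_self_nonneg u)
    have hω : 0 < √μ := Real.sqrt_pos.2 hμpos
    have hlim := h _ _ (isDampedMotion_cos_smul (ω := √μ)
      (by rwa [Real.sq_sqrt hμpos.le]) (mulVec_eq_zero_of_mem_undampedSpace hu))
    have hperiods : Tendsto (fun k : ℕ => (k : ℝ) * (2 * Real.pi) / √μ) atTop atTop :=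
      (tendsto_natCast_atTop_atTop.atTop_mul_const Real.two_pi_pos).atTop_div_const hω
    refine tendsto_nhds_unique (tendsto_const_nhds (f := atTop))
      ((hlim.comp hperiods).congr fun k => ?_)
    rw [Function.comp_apply, mul_div_cancel₀ _ hω.ne', Real.cos_nat_mul_two_pi, one_smul]
  · have hker : Tendsto f (𝓝ˢ (undampedSpace A L)) (𝓝ˢ {0}) := hf.tendsto_nhdsSet fun u hu => h hu
    rw [nhdsSet_singleton] at hker
    exact hker.comp (hzv.tendsto_nhdsSet_undampedSpace hA hL)

end DampedMotion

section Accretive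

theorem maxGenEigenspace_eq_eigenspace_of_disjoint {R V : Type*} [CommRing R] [AddCommGroup V]
    [Module R V] {f : Module.End R V} {z : R}
    (h : Disjoint (f.eigenspace z) (LinearMap.range (f - z • 1))) :
    f.maxGenEigenspace z = f.eigenspace z := by
  refine le_antisymm (fun u hu => ?_) (Module.End.genEigenspace_le_maximal f z 1)
  obtain ⟨k, hk⟩ := (f.mem_maxGenEigenspace z u).1 hu
  induction k with
  | zero => exact (show u = 0 by simpa using hk) ▸ Submodule.zero_mem _
  | succ k ih =>
    rw [pow_succ', Module.End.mul_apply] at hk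
    have heigen : ((f - z • 1) ^ k) u ∈ f.eigenspace z :=
      Module.End.mem_eigenspace_iff.2 (by simpa [sub_eq_zero] using hk)
    rcases k with - | k
    · simpa using heigen
    · refine ih (Submodule.disjoint_def.1 h _ heigen ⟨((f - z • 1) ^ k) u, ?_⟩)
      rw [pow_succ', Module.End.mul_apply]

theorem finrank_biSup_of_iSupIndep {K V κ : Type*} [DivisionRing K] [AddCommGroup V] [Module K V]
    [FiniteDimensional K V] {f : κ → Submodule K V} (hf : iSupIndep f) (s : Finset κ) :
    Module.finrank K (⨆ i ∈ s, f i : Submodule K V) = ∑ i ∈ s, Module.finrank K (f i) := by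
  classical
  induction s using Finset.induction_on with
  | empty => simp
  | insert a s ha ih =>
    have hdisj : Disjoint (f a) (⨆ i ∈ s, f i) := (hf a).mono_right
      (iSup₂_le fun i hi => le_iSup₂_of_le i (ne_of_mem_of_not_mem hi ha) le_rfl)
    rw [Finset.iSup_insert, Finset.sum_insert ha, ← ih, ← Submodule.finrank_sup_add_finrank_inf_eq,
      hdisj.eq_bot, finrank_bot, add_zero]

theorem add_conjTranspose_add_I_smul {ι : Type*} {A L : Matrix ι ι ℂ} (hA : A.IsHermitian)
    (hL : L.IsHermitian) :
    L + Complex.I • A + (L + Complex.I • A)ᴴ = L + L := by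
  rw [conjTranspose_add, conjTranspose_smul, hA.eq, hL.eq, RCLike.star_def, Complex.conj_I]
  module

open scoped ComplexOrder

variable {ι : Type*} [Fintype ι] {X A L : Matrix ι ι ℂ} {v : ι → ℂ} {z : ℂ}

theorem star_dotProduct_add_conjTranspose_mulVec (h : X *ᵥ v = z • v) :
    star v ⬝ᵥ ((X + Xᴴ) *ᵥ v) = (2 * z.re : ℝ) * (star v ⬝ᵥ v) := by
  have hadj : star v ⬝ᵥ (Xᴴ *ᵥ v) = star z * (star v ⬝ᵥ v) := by
    rw [dotProduct_mulVec, ← star_mulVec, h, star_smul, smul_dotProduct, smul_eq_mul]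
  rw [add_mulVec, dotProduct_add, hadj, h, dotProduct_smul, smul_eq_mul, ← add_mul]
  exact congrArg (· * _) (Complex.add_conj z)

theorem re_nonneg_of_mulVec_eq_smul (hX : (X + Xᴴ).PosSemidef) (hv : v ≠ 0)
    (h : X *ᵥ v = z • v) : 0 ≤ z.re := by
  have hnonneg := hX.dotProduct_mulVec_nonneg v
  rw [star_dotProduct_add_conjTranspose_mulVec h] at hnonneg
  have hre := (Complex.nonneg_iff.1 hnonneg).1
  rw [Complex.re_ofReal_mul] at hre
  have := nonneg_of_mul_nonneg_left hre (Complex.pos_iff.1 (dotProduct_star_self_pos_iff.2 hv)).1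
  linarith

theorem add_conjTranspose_mulVec_eq_zero (hX : (X + Xᴴ).PosSemidef) (hz : z.re = 0)
    (h : X *ᵥ v = z • v) : (X + Xᴴ) *ᵥ v = 0 := by
  rw [← hX.dotProduct_mulVec_zero_iff, star_dotProduct_add_conjTranspose_mulVec h, hz]
  simp

variable [DecidableEq ι]

/-- An eigenvector of `X` for an imaginary `z` is one of `Xᴴ` for `star z`, hence orthogonal to the
range of `X - z`. -/
theorem maxGenEigenspace_toLin'_eq_eigenspace (hX : (X + Xᴴ).PosSemidef) (hz : z.re = 0) :
    Module.End.maxGenEigenspace (toLin' X) z = Module.End.eigenspace (toLin' X) z := by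
  refine maxGenEigenspace_eq_eigenspace_of_disjoint (Submodule.disjoint_def.2 ?_)
  rintro w hw ⟨u, hu⟩
  have hXw : X *ᵥ w = z • w := Module.End.mem_eigenspace_iff.1 hw
  have hw_eq : X *ᵥ u - z • u = w := by simpa using hu
  have hadj : Xᴴ *ᵥ w = star z • w := by
    have hzero := add_conjTranspose_mulVec_eq_zero hX hz hXw
    have hstar : star z = -z := Complex.ext (by simp [hz]) (by simp)
    rw [add_mulVec, hXw] at hzero
    rw [hstar, neg_smul, eq_neg_of_add_eq_zero_right hzero]
  refine dotProduct_star_self_eq_zero.1 ?_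
  calc star w ⬝ᵥ w = star w ⬝ᵥ (X *ᵥ u - z • u) := by rw [hw_eq]
    _ = star (Xᴴ *ᵥ w) ⬝ᵥ u - z * (star w ⬝ᵥ u) := by
        rw [dotProduct_sub, dotProduct_smul, smul_eq_mul, dotProduct_mulVec, star_mulVec,
          conjTranspose_conjTranspose]
    _ = 0 := by rw [hadj, star_smul, star_star, smul_dotProduct, smul_eq_mul, sub_self]

theorem mem_roots_charpoly_iff_hasEigenvalue {K : Type*} [Field K] {X : Matrix ι ι K} {z : K} :
    z ∈ X.charpoly.roots ↔ Module.End.HasEigenvalue (toLin' X) z := by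
  rw [Polynomial.mem_roots X.charpoly_monic.ne_zero, Module.End.hasEigenvalue_iff_isRoot_charpoly,
    charpoly_toLin']

theorem re_nonneg_of_mem_roots_charpoly (hX : (X + Xᴴ).PosSemidef)
    (hz : z ∈ X.charpoly.roots) : 0 ≤ z.re := by
  obtain ⟨v, hv⟩ := (mem_roots_charpoly_iff_hasEigenvalue.1 hz).exists_hasEigenvector
  exact re_nonneg_of_mulVec_eq_smul hX hv.2 hv.apply_eq_smul

theorem imagAxisCount_eq_finrank_biSup_eigenspace (hX : (X + Xᴴ).PosSemidef) :
    imagAxisCount X = Module.finrank ℂ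
      (⨆ (z : ℂ) (_ : z.re = 0), Module.End.eigenspace (toLin' X) z : Submodule ℂ (ι → ℂ)) := by
  let s := X.charpoly.roots.toFinset.filter fun z => z.re = 0
  have hs : ⨆ (z : ℂ) (_ : z.re = 0), Module.End.eigenspace (toLin' X) z =
      ⨆ z ∈ s, Module.End.eigenspace (toLin' X) z := by
    refine le_antisymm (iSup₂_le fun z hz => ?_)
      (iSup₂_le fun z hz => le_iSup₂_of_le z (Finset.mem_filter.1 hz).2 le_rfl)
    by_cases hroot : z ∈ X.charpoly.roots
    · exact le_iSup₂_of_le z (Finset.mem_filter.2 ⟨Multiset.mem_toFinset.2 hroot, hz⟩) le_rfl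
    · rw [mem_roots_charpoly_iff_hasEigenvalue, Module.End.hasEigenvalue_iff, not_not] at hroot
      exact hroot.trans_le bot_le
  rw [hs, finrank_biSup_of_iSupIndep (Module.End.eigenspaces_iSupIndep _), imagAxisCount,
    Multiset.countP_eq_card_filter, ← Multiset.toFinset_sum_count_eq, Multiset.toFinset_filter]
  refine Finset.sum_congr rfl fun z hz => ?_
  have hre : z.re = 0 := (Finset.mem_filter.1 hz).2
  rw [Multiset.count_filter_of_pos (p := fun z : ℂ => z.re = 0) hre, Polynomial.count_roots,
    ← charpoly_toLin', ← LinearMap.finrank_maxGenEigenspace_eq,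
    maxGenEigenspace_toLin'_eq_eigenspace hX hre]

theorem biSup_eigenspace_add_I_smul_eq_undampedSpace (hA : A.IsHermitian) (hL : L.PosSemidef) :
    ⨆ (z : ℂ) (_ : z.re = 0), Module.End.eigenspace (toLin' (L + Complex.I • A)) z =
      undampedSpace A L := by
  have hsum := add_conjTranspose_add_I_smul hA hL.1
  refine le_antisymm (iSup₂_le fun z hz v hv => ?_)
    (le_of_forall_eigenvector_mem hA (fun _ => mulVec_mem_undampedSpace) fun v hv μ hμ => ?_)
  · have hzv : (L + Complex.I • A) *ᵥ v = z • v := Module.End.mem_eigenspace_iff.1 hv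
    have hLv : L *ᵥ v = 0 := by
      have := add_conjTranspose_mulVec_eq_zero (hsum ▸ hL.add hL) hz hzv
      rwa [hsum, add_mulVec, ← two_smul ℂ, smul_eq_zero_iff_right two_ne_zero] at this
    rw [add_mulVec, hLv, zero_add, smul_mulVec] at hzv
    refine mem_undampedSpace_of_mulVec_eq_smul (μ := -Complex.I * z) ?_ hLv
    rw [mul_smul, ← hzv, smul_smul, neg_mul, Complex.I_mul_I, neg_neg, one_smul]
  · refine Submodule.mem_iSup_of_mem (Complex.I * μ) (Submodule.mem_iSup_of_mem (by simp)
      (Module.End.mem_eigenspace_iff.2 ?_))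
    rw [toLin'_apply, add_mulVec, mulVec_eq_zero_of_mem_undampedSpace hv, smul_mulVec, hμ,
      smul_smul, zero_add]
    rfl

theorem imagAxisCount_add_I_smul (hA : A.IsHermitian) (hL : L.PosSemidef) :
    imagAxisCount (L + Complex.I • A) = Module.finrank ℂ (undampedSpace A L) := by
  rw [imagAxisCount_eq_finrank_biSup_eigenspace
      (add_conjTranspose_add_I_smul hA hL.1 ▸ hL.add hL),
    biSup_eigenspace_add_I_smul_eq_undampedSpace hA hL]

end Accretive

section Complexification

open scoped ComplexOrder

variable {ι : Type*}

theorem posSemidef_map_ofReal [Finite ι] {L : Matrix ι ι ℝ} (hL : L.PosSemidef) :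
    (L.map Complex.ofReal).PosSemidef := by
  classical
  have := Fintype.ofFinite ι
  obtain ⟨B, rfl⟩ := CStarAlgebra.nonneg_iff_eq_star_mul_self.1 hL.nonneg
  have hmap : (star B * B).map Complex.ofReal =
      (B.map Complex.ofReal)ᴴ * B.map Complex.ofReal := by
    ext i j
    simp [mul_apply, star_eq_conjTranspose]
  exact hmap ▸ posSemidef_conjTranspose_mul_self _

variable [Fintype ι]

theorem re_comp_map_ofReal_mulVec {κ : Type*} (A : Matrix κ ι ℝ) (v : ι → ℂ) :
    Complex.re ∘ (A.map Complex.ofReal *ᵥ v) = A *ᵥ (Complex.re ∘ v) := by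
  ext i
  simp [mulVec, dotProduct]

theorem im_comp_map_ofReal_mulVec {κ : Type*} (A : Matrix κ ι ℝ) (v : ι → ℂ) :
    Complex.im ∘ (A.map Complex.ofReal *ᵥ v) = A *ᵥ (Complex.im ∘ v) := by
  ext i
  simp [mulVec, dotProduct]

theorem map_ofReal_mulVec_eq_zero {κ : Type*} {A : Matrix κ ι ℝ} {v : ι → ℂ} :
    A.map Complex.ofReal *ᵥ v = 0 ↔ A *ᵥ (Complex.re ∘ v) = 0 ∧ A *ᵥ (Complex.im ∘ v) = 0 := by
  simp only [← re_comp_map_ofReal_mulVec, ← im_comp_map_ofReal_mulVec, funext_iff,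
    Function.comp_apply, Pi.zero_apply, Complex.ext_iff, Complex.zero_re, Complex.zero_im,
    forall_and]

variable [DecidableEq ι] {A L : Matrix ι ι ℝ}

theorem mem_undampedSpace_map_ofReal {v : ι → ℂ} :
    v ∈ undampedSpace (A.map Complex.ofReal) (L.map Complex.ofReal) ↔
      Complex.re ∘ v ∈ undampedSpace A L ∧ Complex.im ∘ v ∈ undampedSpace A L := by
  have hmap (k : ℕ) : L.map Complex.ofReal * A.map Complex.ofReal ^ k =
      (L * A ^ k).map Complex.ofReal := by
    change Complex.ofRealHom.mapMatrix L * Complex.ofRealHom.mapMatrix A ^ k =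
      Complex.ofRealHom.mapMatrix (L * A ^ k)
    rw [map_mul, map_pow]
  simp only [mem_undampedSpace, hmap, map_ofReal_mulVec_eq_zero, forall_and]

theorem finrank_undampedSpace_map_ofReal :
    Module.finrank ℂ (undampedSpace (A.map Complex.ofReal) (L.map Complex.ofReal)) =
      Module.finrank ℝ (undampedSpace A L) := by
  let e : undampedSpace (A.map Complex.ofReal) (L.map Complex.ofReal) ≃ₗ[ℝ]
      undampedSpace A L × undampedSpace A L :=
    { toFun v := (⟨_, (mem_undampedSpace_map_ofReal.1 v.2).1⟩,
        ⟨_, (mem_undampedSpace_map_ofReal.1 v.2).2⟩)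
      map_add' _ _ := rfl
      map_smul' a v := by ext i <;> simp
      invFun p := ⟨fun i => ⟨p.1.1 i, p.2.1 i⟩, mem_undampedSpace_map_ofReal.2 ⟨p.1.2, p.2.2⟩⟩
      left_inv _ := rfl
      right_inv _ := rfl }
  have hdim := e.finrank_eq
  rw [finrank_real_of_complex, Module.finrank_prod] at hdim
  lia

theorem imagAxisCount_map_ofReal (hA : A.IsHermitian) (hL : L.PosSemidef) :
    imagAxisCount (L.map Complex.ofReal + Complex.I • A.map Complex.ofReal) =
      Module.finrank ℝ (undampedSpace A L) := by
  rw [imagAxisCount_add_I_smul (hA.map _ fun _ => by simp) (posSemidef_map_ofReal hL),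
    finrank_undampedSpace_map_ofReal]

end Complexification

theorem imagAxisCount_eq_iff_re_pos {ι : Type*} [Fintype ι] [DecidableEq ι] {X : Matrix ι ι ℂ}
    {lam : Fin (Fintype.card ι) → ℂ} (h : IsEigenvalueOrdering X lam)
    (hre : ∀ z ∈ X.charpoly.roots, 0 ≤ z.re) {n : ℕ} (hn : n < Fintype.card ι)
    (hcount : n ≤ imagAxisCount X) : imagAxisCount X = n ↔ 0 < (lam ⟨n, hn⟩).re := by
  have hnonneg (k) : 0 ≤ (lam k).re :=
    hre _ (h.1 ▸ Multiset.mem_map_of_mem _ (Finset.mem_univ k))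
  have hcard : imagAxisCount X = (Finset.univ.filter fun k => (lam k).re ≤ 0).card := by
    rw [imagAxisCount, ← h.1, Multiset.countP_map]
    simp only [(hnonneg _).ge_iff_eq']
    rfl
  rw [← not_le, ← Tuple.lt_card_le_iff_apply_le_of_monotone h.2, ← hcard, not_lt]
  exact ⟨fun hle => hle.le, fun hle => hle.antisymm hcount⟩

section Synchronous

variable (R ι κ : Type*) [CommRing R]

/-- The family of all differences `zᵢ - zⱼ` between the blocks of the stacked vector `z`. -/
def disagreement : (ι × κ → R) →ₗ[R] ι → ι → κ → R where
  toFun z i j := Function.curry z i - Function.curry z j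
  map_add' _ _ := by ext; simp [Function.curry]; ring
  map_smul' _ _ := by ext; simp [Function.curry]; ring

/-- The stacked vectors all of whose blocks coincide. -/
def syncSpace : Submodule R (ι × κ → R) :=
  LinearMap.ker (disagreement R ι κ)

variable {R ι κ}

theorem mem_syncSpace {z : ι × κ → R} :
    z ∈ syncSpace R ι κ ↔ ∀ i j, Function.curry z i = Function.curry z j := by
  simp [syncSpace, disagreement, funext_iff, sub_eq_zero]

variable (R ι κ) in
theorem finrank_syncSpace [Nontrivial R] [Nonempty ι] [Fintype κ] :
    Module.finrank R (syncSpace R ι κ) = Fintype.card κ := by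
  let e : syncSpace R ι κ ≃ₗ[R] (κ → R) :=
    { toFun z := Function.curry z.1 (Classical.arbitrary ι)
      map_add' _ _ := rfl
      map_smul' _ _ := rfl
      invFun u := ⟨fun p => u p.2, mem_syncSpace.2 fun _ _ => rfl⟩
      left_inv z := Subtype.ext (funext fun p => congrFun (mem_syncSpace.1 z.2 _ p.1) p.2)
      right_inv _ := rfl }
  rw [e.finrank_eq, Module.finrank_fintype_fun_eq_card]

end Synchronous

section Laplacian

variable {n q : ℕ} {W : Fin q → Fin q → Matrix (Fin n) (Fin n) ℝ}

theorem curry_lap_mulVec (hW : ∀ i, W i i = 0) (z : Fin q × Fin n → ℝ) (i : Fin q) :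
    Function.curry (lap W *ᵥ z) i =
      ∑ j, W i j *ᵥ (Function.curry z i - Function.curry z j) := by
  have hblock : ∀ a k, ∑ b, lap W (i, a) (k, b) * z (k, b) =
      (if i = k then ((∑ j, W i j) *ᵥ Function.curry z i) a else 0) -
        (W i k *ᵥ Function.curry z k) a := by
    intro a k
    by_cases hk : i = k
    · subst hk
      simp [lap, hW, mulVec, dotProduct]
    · simp [lap, hk, mulVec, dotProduct]
  ext a
  rw [Function.curry_apply, mulVec, dotProduct, Fintype.sum_prod_type]
  simp only [hblock, Finset.sum_sub_distrib, Finset.sum_ite_eq, Finset.mem_univ, if_true,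
    mulVec_sub, sum_mulVec, Finset.sum_apply, Pi.sub_apply]

theorem lap_mulVec_eq_zero (hW : ∀ i, W i i = 0) {z : Fin q × Fin n → ℝ}
    (hz : z ∈ syncSpace ℝ (Fin q) (Fin n)) : lap W *ᵥ z = 0 := by
  refine Function.curry_injective (funext fun i => ?_)
  rw [curry_lap_mulVec hW]
  exact Finset.sum_eq_zero fun j _ => by rw [mem_syncSpace.1 hz i j, sub_self, mulVec_zero]

theorem isHermitian_lap (hherm : ∀ i j, (W i j).IsHermitian) (hsymm : ∀ i j, W i j = W j i) :
    (lap W).IsHermitian := by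
  ext ⟨i, a⟩ ⟨k, b⟩
  have hentry (i j) : W i j b a = W i j a b := by simpa using (hherm i j).apply a b
  by_cases hk : i = k
  · subst hk
    simp [lap, Matrix.sum_apply, hentry]
  · simp [lap, hk, Ne.symm hk, hsymm k i, hentry]

theorem two_mul_dotProduct_lap_mulVec (hsymm : ∀ i j, W i j = W j i) (hW : ∀ i, W i i = 0)
    (z : Fin q × Fin n → ℝ) :
    2 * (z ⬝ᵥ (lap W *ᵥ z)) = ∑ i, ∑ j, (Function.curry z i - Function.curry z j) ⬝ᵥ
      (W i j *ᵥ (Function.curry z i - Function.curry z j)) := by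
  have hrow : z ⬝ᵥ (lap W *ᵥ z) = ∑ i, ∑ j, Function.curry z i ⬝ᵥ
      (W i j *ᵥ (Function.curry z i - Function.curry z j)) := by
    simp only [← dotProduct_sum, ← curry_lap_mulVec hW]
    exact Fintype.sum_prod_type _
  have hswap : z ⬝ᵥ (lap W *ᵥ z) = -∑ i, ∑ j, Function.curry z j ⬝ᵥ
      (W i j *ᵥ (Function.curry z i - Function.curry z j)) := by
    rw [hrow, Finset.sum_comm]
    simp only [← Finset.sum_neg_distrib, ← dotProduct_neg, ← mulVec_neg, neg_sub]
    exact Finset.sum_congr rfl fun j _ => Finset.sum_congr rfl fun i _ => by rw [hsymm]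
  simp only [sub_dotProduct, Finset.sum_sub_distrib]
  linarith

theorem posSemidef_lap (hpsd : ∀ i j, (W i j).PosSemidef) (hsymm : ∀ i j, W i j = W j i)
    (hW : ∀ i, W i i = 0) : (lap W).PosSemidef := by
  refine PosSemidef.of_dotProduct_mulVec_nonneg
    (isHermitian_lap (fun i j => (hpsd i j).1) hsymm) fun z => ?_
  have hsum : 0 ≤ 2 * (z ⬝ᵥ (lap W *ᵥ z)) := by
    rw [two_mul_dotProduct_lap_mulVec hsymm hW]
    exact Finset.sum_nonneg fun i _ => Finset.sum_nonneg fun j _ => by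
      simpa using (hpsd i j).dotProduct_mulVec_nonneg (Function.curry z i - Function.curry z j)
  simpa using hsum

theorem curry_one_kronecker_mulVec {R ι κ : Type*} [CommSemiring R] [Fintype ι] [DecidableEq ι]
    [Fintype κ] (P : Matrix κ κ R) (z : ι × κ → R) (i : ι) :
    Function.curry (((1 : Matrix ι ι R) ⊗ₖ P) *ᵥ z) i = P *ᵥ Function.curry z i := by
  ext a
  rw [Function.curry_apply, mulVec, dotProduct, Fintype.sum_prod_type]
  simp [one_apply, mulVec, dotProduct, ite_mul]

end Laplacian

section SquareRoot

variable {n : ℕ} {M : Matrix (Fin n) (Fin n) ℝ}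

theorem posDef_sqrt (hM : M.PosDef) : (CFC.sqrt M).PosDef :=
  hM.isStrictlyPositive.sqrt.posDef

theorem sqrt_mul_invSqrt (hM : M.PosDef) : CFC.sqrt M * invSqrt M = 1 :=
  mul_nonsing_inv _ ((isUnit_iff_isUnit_det _).1 (posDef_sqrt hM).isUnit)

theorem invSqrt_mul_sqrt (hM : M.PosDef) : invSqrt M * CFC.sqrt M = 1 :=
  nonsing_inv_mul _ ((isUnit_iff_isUnit_det _).1 (posDef_sqrt hM).isUnit)

theorem mul_invSqrt (hM : M.PosDef) : M * invSqrt M = CFC.sqrt M := by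
  calc M * invSqrt M = CFC.sqrt M * CFC.sqrt M * invSqrt M := by
        rw [CFC.sqrt_mul_sqrt_self M hM.posSemidef.nonneg]
    _ = CFC.sqrt M := by rw [mul_assoc, sqrt_mul_invSqrt hM, mul_one]

theorem sqrt_mulVec_invSqrt_mul_mul_mulVec (hM : M.PosDef) (B : Matrix (Fin n) (Fin n) ℝ)
    (u : Fin n → ℝ) :
    CFC.sqrt M *ᵥ ((invSqrt M * B * invSqrt M) *ᵥ u) = B *ᵥ (invSqrt M *ᵥ u) := by
  rw [mulVec_mulVec, mul_assoc (invSqrt M), ← mul_assoc, sqrt_mul_invSqrt hM, one_mul,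
    mulVec_mulVec]

theorem posDef_invSqrt (hM : M.PosDef) : (invSqrt M).PosDef := (posDef_sqrt hM).inv

theorem posSemidef_invSqrt_mul_mul (hM : M.PosDef) {B : Matrix (Fin n) (Fin n) ℝ}
    (hB : B.PosSemidef) : (invSqrt M * B * invSqrt M).PosSemidef := by
  have := hB.mul_mul_conjTranspose_same (invSqrt M)
  rwa [(posDef_invSqrt hM).1.eq] at this

theorem posDef_matP (hM : M.PosDef) {K : Matrix (Fin n) (Fin n) ℝ} (hK : K.PosDef) :
    (matP M K).PosDef :=
  (posSemidef_invSqrt_mul_mul hM hK.posSemidef).posDef_iff_isUnit.2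
    (((posDef_invSqrt hM).isUnit.mul hK.isUnit).mul (posDef_invSqrt hM).isUnit)

end SquareRoot

section Array

variable {n q : ℕ} {M K : Matrix (Fin n) (Fin n) ℝ}
  {D R W : Fin q → Fin q → Matrix (Fin n) (Fin n) ℝ}

/-- The stiffness `I ⊗ P + L_r` of the array in the coordinates `zᵢ = M ^ (1/2) xᵢ`. -/
noncomputable def arrayStiffness (M K : Matrix (Fin n) (Fin n) ℝ)
    (R : Fin q → Fin q → Matrix (Fin n) (Fin n) ℝ) :
    Matrix (Fin q × Fin n) (Fin q × Fin n) ℝ :=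
  (1 : Matrix (Fin q) (Fin q) ℝ) ⊗ₖ matP M K + couplingLap M R

theorem curry_couplingLap_mulVec (hW : ∀ i, W i i = 0) (z : Fin q × Fin n → ℝ) (i : Fin q) :
    Function.curry (couplingLap M W *ᵥ z) i = ∑ j, (invSqrt M * W i j * invSqrt M) *ᵥ
      (Function.curry z i - Function.curry z j) :=
  curry_lap_mulVec (fun i => by simp [hW]) z i

theorem curry_arrayStiffness_mulVec (hRdiag : ∀ i, R i i = 0) (z : Fin q × Fin n → ℝ)
    (i : Fin q) :
    Function.curry (arrayStiffness M K R *ᵥ z) i = matP M K *ᵥ Function.curry z i +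
      ∑ j, (invSqrt M * R i j * invSqrt M) *ᵥ (Function.curry z i - Function.curry z j) := by
  rw [← curry_one_kronecker_mulVec, ← curry_couplingLap_mulVec hRdiag, arrayStiffness, add_mulVec]
  rfl

theorem posSemidef_couplingLap (hM : M.PosDef) (hpsd : ∀ i j, (W i j).PosSemidef)
    (hsymm : ∀ i j, W i j = W j i) (hW : ∀ i, W i i = 0) : (couplingLap M W).PosSemidef :=
  posSemidef_lap (fun i j => posSemidef_invSqrt_mul_mul hM (hpsd i j))
    (fun i j => by rw [hsymm i j]) (fun i => by simp [hW])

theorem posDef_arrayStiffness (hM : M.PosDef) (hK : K.PosDef) (hR : ∀ i j, (R i j).PosSemidef)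
    (hRsymm : ∀ i j, R i j = R j i) (hRdiag : ∀ i, R i i = 0) :
    (arrayStiffness M K R).PosDef :=
  (PosDef.one.kronecker (posDef_matP hM hK)).add_posSemidef
    (posSemidef_couplingLap hM hR hRsymm hRdiag)

theorem syncSpace_le_undampedSpace (hDdiag : ∀ i, D i i = 0) (hRdiag : ∀ i, R i i = 0) :
    syncSpace ℝ (Fin q) (Fin n) ≤ undampedSpace (arrayStiffness M K R) (couplingLap M D) := by
  have hkill : ∀ {W : Fin q → Fin q → Matrix (Fin n) (Fin n) ℝ}, (∀ i, W i i = 0) →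
      ∀ z ∈ syncSpace ℝ (Fin q) (Fin n), couplingLap M W *ᵥ z = 0 :=
    fun hW z hz => lap_mulVec_eq_zero (fun i => by simp [hW]) hz
  refine le_undampedSpace (fun z hz => mem_syncSpace.2 fun i j => ?_) (hkill hDdiag)
  rw [arrayStiffness, add_mulVec, hkill hRdiag z hz, add_zero, curry_one_kronecker_mulVec,
    curry_one_kronecker_mulVec, mem_syncSpace.1 hz i j]

theorem residual_eq_sqrt_mulVec_curry (hM : M.PosDef) (hDdiag : ∀ i, D i i = 0)
    (hRdiag : ∀ i, R i i = 0) (z v w : Fin q × Fin n → ℝ) (i : Fin q) :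
    M *ᵥ (invSqrt M *ᵥ Function.curry w i) + K *ᵥ (invSqrt M *ᵥ Function.curry z i)
      + ∑ j, D i j *ᵥ (invSqrt M *ᵥ Function.curry v i - invSqrt M *ᵥ Function.curry v j)
      + ∑ j, R i j *ᵥ (invSqrt M *ᵥ Function.curry z i - invSqrt M *ᵥ Function.curry z j) =
    CFC.sqrt M *ᵥ
      Function.curry (w + arrayStiffness M K R *ᵥ z + couplingLap M D *ᵥ v) i := by
  have hcurry : Function.curry (w + arrayStiffness M K R *ᵥ z + couplingLap M D *ᵥ v) i =
      Function.curry w i + Function.curry (arrayStiffness M K R *ᵥ z) i +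
        Function.curry (couplingLap M D *ᵥ v) i := rfl
  rw [hcurry, curry_arrayStiffness_mulVec hRdiag, curry_couplingLap_mulVec hDdiag, matP]
  simp only [← mulVec_sub, mulVec_add, mulVec_sum, sqrt_mulVec_invSqrt_mul_mul_mulVec hM]
  rw [mulVec_mulVec, mul_invSqrt hM]
  abel

theorem IsSolution.isDampedMotion (hM : M.PosDef) (hDdiag : ∀ i, D i i = 0)
    (hRdiag : ∀ i, R i i = 0) {x : Fin q → ℝ → Fin n → ℝ} (hx : IsSolution M K D R x) :
    IsDampedMotion (arrayStiffness M K R) (couplingLap M D)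
      (fun t => Function.uncurry fun i => CFC.sqrt M *ᵥ x i t)
      (fun t => Function.uncurry fun i => CFC.sqrt M *ᵥ deriv (x i) t) := by
  obtain ⟨hx₁, hx₂, hx⟩ := hx
  have hstack : ∀ {y : Fin q → ℝ → Fin n → ℝ}, (∀ i, Differentiable ℝ (y i)) → ∀ t,
      HasDerivAt (fun t => Function.uncurry fun i => CFC.sqrt M *ᵥ y i t)
        (Function.uncurry fun i => CFC.sqrt M *ᵥ deriv (y i) t) t := fun hy t =>
    hasDerivAt_pi.2 fun p => hasDerivAt_pi.1 (hasDerivAt_mulVec _ (hy p.1 t).hasDerivAt) p.2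
  refine ⟨hstack hx₁, fun t => (hstack hx₂ t).congr_deriv ?_⟩
  rw [← sub_eq_zero, sub_sub_eq_add_sub, sub_neg_eq_add, add_right_comm]
  refine Function.curry_injective (funext fun i => ?_)
  refine mulVec_injective_of_isUnit (posDef_sqrt hM).isUnit ?_
  rw [← residual_eq_sqrt_mulVec_curry hM hDdiag hRdiag]
  refine Eq.trans ?_ (mulVec_zero _).symm
  simpa [Function.curry_uncurry, invSqrt_mul_sqrt hM] using hx i t

theorem IsDampedMotion.isSolution (hM : M.PosDef) (hDdiag : ∀ i, D i i = 0)
    (hRdiag : ∀ i, R i i = 0) {z v : ℝ → Fin q × Fin n → ℝ}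
    (h : IsDampedMotion (arrayStiffness M K R) (couplingLap M D) z v) :
    IsSolution M K D R fun i t => invSqrt M *ᵥ Function.curry (z t) i := by
  have hblock : ∀ {y : ℝ → Fin q × Fin n → ℝ} {y' : Fin q × Fin n → ℝ} {t : ℝ},
      HasDerivAt y y' t → ∀ i, HasDerivAt (fun t => invSqrt M *ᵥ Function.curry (y t) i)
        (invSqrt M *ᵥ Function.curry y' i) t := fun hy i =>
    hasDerivAt_mulVec _ (hasDerivAt_pi.2 fun a => hasDerivAt_pi.1 hy (i, a))
  have hderiv (i) : deriv (fun t => invSqrt M *ᵥ Function.curry (z t) i) =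
      fun t => invSqrt M *ᵥ Function.curry (v t) i :=
    funext fun t => (hblock (h.position t) i).deriv
  refine ⟨fun i t => (hblock (h.position t) i).differentiableAt, fun i t => ?_, fun i t => ?_⟩
  · rw [hderiv]
    exact (hblock (h.velocity t) i).differentiableAt
  · simp only [hderiv, (hblock (h.velocity t) i).deriv]
    rw [residual_eq_sqrt_mulVec_curry hM hDdiag hRdiag, sub_add_eq_add_sub, neg_add_cancel,
      zero_sub, neg_add_cancel]
    exact mulVec_zero _

theorem tendsto_mulVec_zero {α ι κ : Type*} [Fintype ι] (B : Matrix κ ι ℝ) {l : Filter α}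
    {y : α → ι → ℝ} (hy : Tendsto y l (𝓝 0)) : Tendsto (fun t => B *ᵥ y t) l (𝓝 0) := by
  have hB : Continuous fun u => B *ᵥ u := continuous_const.matrix_mulVec continuous_id
  simpa [Function.comp_def] using (hB.tendsto 0).comp hy

theorem tendsto_norm_toLp_zero_iff {α ι : Type*} [Fintype ι] {l : Filter α} {y : α → ι → ℝ} :
    Tendsto (fun t => ‖WithLp.toLp 2 (y t)‖) l (𝓝 0) ↔ Tendsto y l (𝓝 0) := by
  rw [← tendsto_zero_iff_norm_tendsto_zero]
  have hind := (PiLp.homeomorph 2 fun _ : ι => ℝ).symm.isInducing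
  exact (hind.tendsto_nhds_iff (y := (0 : ι → ℝ))).symm

theorem synchronizes_iff_forall_isDampedMotion (hM : M.PosDef) (hDdiag : ∀ i, D i i = 0)
    (hRdiag : ∀ i, R i i = 0) :
    Synchronizes M K D R ↔ ∀ z v, IsDampedMotion (arrayStiffness M K R) (couplingLap M D) z v →
      Tendsto (fun t => disagreement ℝ (Fin q) (Fin n) (z t)) atTop (𝓝 0) := by
  simp only [Synchronizes, tendsto_norm_toLp_zero_iff]
  refine ⟨fun h z v hzv => ?_, fun h x hx i j => ?_⟩
  · refine tendsto_pi_nhds.2 fun i => tendsto_pi_nhds.2 fun j => ?_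
    refine (tendsto_mulVec_zero (CFC.sqrt M)
      (h _ (hzv.isSolution hM hDdiag hRdiag) i j)).congr fun t => ?_
    rw [← mulVec_sub, mulVec_mulVec, sqrt_mul_invSqrt hM, one_mulVec]
    rfl
  · have hij := tendsto_pi_nhds.1 (tendsto_pi_nhds.1
      (h _ _ (hx.isDampedMotion hM hDdiag hRdiag)) i) j
    refine (tendsto_mulVec_zero (invSqrt M) hij).congr fun t => ?_
    change invSqrt M *ᵥ (CFC.sqrt M *ᵥ x i t - CFC.sqrt M *ᵥ x j t) = _
    rw [← mulVec_sub, mulVec_mulVec, invSqrt_mul_sqrt hM, one_mulVec]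

theorem synchronizes_iff_undampedSpace_le_syncSpace (hM : M.PosDef) (hK : K.PosDef)
    (hD : ∀ i j, (D i j).PosSemidef) (hDsymm : ∀ i j, D i j = D j i) (hDdiag : ∀ i, D i i = 0)
    (hR : ∀ i j, (R i j).PosSemidef) (hRsymm : ∀ i j, R i j = R j i) (hRdiag : ∀ i, R i i = 0) :
    Synchronizes M K D R ↔
      undampedSpace (arrayStiffness M K R) (couplingLap M D) ≤ syncSpace ℝ (Fin q) (Fin n) :=
  (synchronizes_iff_forall_isDampedMotion hM hDdiag hRdiag).trans
    (forall_tendsto_zero_iff_undampedSpace_le_ker (posDef_arrayStiffness hM hK hR hRsymm hRdiag)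
      (posSemidef_couplingLap hM hD hDsymm hDdiag) _)

theorem imagAxisCount_matGamma (hM : M.PosDef) (hK : K.PosDef)
    (hD : ∀ i j, (D i j).PosSemidef) (hDsymm : ∀ i j, D i j = D j i) (hDdiag : ∀ i, D i i = 0)
    (hR : ∀ i j, (R i j).PosSemidef) (hRsymm : ∀ i j, R i j = R j i) (hRdiag : ∀ i, R i i = 0) :
    imagAxisCount (matGamma M K D R) =
      Module.finrank ℝ (undampedSpace (arrayStiffness M K R) (couplingLap M D)) :=
  imagAxisCount_map_ofReal (posDef_arrayStiffness hM hK hR hRsymm hRdiag).1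
    (posSemidef_couplingLap hM hD hDsymm hDdiag)

open scoped ComplexOrder in
theorem posSemidef_matGamma_add_conjTranspose (hM : M.PosDef) (hK : K.PosDef)
    (hD : ∀ i j, (D i j).PosSemidef) (hDsymm : ∀ i j, D i j = D j i) (hDdiag : ∀ i, D i i = 0)
    (hR : ∀ i j, (R i j).PosSemidef) (hRsymm : ∀ i j, R i j = R j i) (hRdiag : ∀ i, R i i = 0) :
    (matGamma M K D R + (matGamma M K D R)ᴴ).PosSemidef := by
  have hA : ((arrayStiffness M K R).map Complex.ofReal).IsHermitian :=
    (posDef_arrayStiffness hM hK hR hRsymm hRdiag).1.map _ fun _ => by simp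
  have hL := posSemidef_map_ofReal (posSemidef_couplingLap hM hD hDsymm hDdiag)
  exact (add_conjTranspose_add_I_smul hA hL.1).symm ▸ hL.add hL

theorem le_imagAxisCount_matGamma (hq : 1 ≤ q) (hM : M.PosDef) (hK : K.PosDef)
    (hD : ∀ i j, (D i j).PosSemidef) (hDsymm : ∀ i j, D i j = D j i) (hDdiag : ∀ i, D i i = 0)
    (hR : ∀ i j, (R i j).PosSemidef) (hRsymm : ∀ i j, R i j = R j i) (hRdiag : ∀ i, R i i = 0) :
    n ≤ imagAxisCount (matGamma M K D R) := by
  have : Nonempty (Fin q) := ⟨⟨0, hq⟩⟩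
  rw [imagAxisCount_matGamma hM hK hD hDsymm hDdiag hR hRsymm hRdiag]
  simpa [finrank_syncSpace] using
    Submodule.finrank_mono (syncSpace_le_undampedSpace (M := M) (K := K) hDdiag hRdiag)

theorem synchronizes_iff_imagAxisCount_eq (hq : 1 ≤ q) (hM : M.PosDef) (hK : K.PosDef)
    (hD : ∀ i j, (D i j).PosSemidef) (hDsymm : ∀ i j, D i j = D j i) (hDdiag : ∀ i, D i i = 0)
    (hR : ∀ i j, (R i j).PosSemidef) (hRsymm : ∀ i j, R i j = R j i) (hRdiag : ∀ i, R i i = 0) :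
    Synchronizes M K D R ↔ imagAxisCount (matGamma M K D R) = n := by
  have : Nonempty (Fin q) := ⟨⟨0, hq⟩⟩
  have hle := syncSpace_le_undampedSpace (M := M) (K := K) hDdiag hRdiag
  have hdim : Module.finrank ℝ (syncSpace ℝ (Fin q) (Fin n)) = n := by simp [finrank_syncSpace]
  rw [synchronizes_iff_undampedSpace_le_syncSpace hM hK hD hDsymm hDdiag hR hRsymm hRdiag,
    imagAxisCount_matGamma hM hK hD hDsymm hDdiag hR hRsymm hRdiag]
  refine ⟨fun hge => by rw [hge.antisymm hle, hdim], fun hcount => ?_⟩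
  exact (Submodule.eq_of_le_of_finrank_eq hle (hdim.trans hcount.symm)).ge

end Array

end SmallOscillations

open SmallOscillations in
theorem mainTheorem1_general (n q : ℕ) (hq : 1 ≤ q)
    (M K : Matrix (Fin n) (Fin n) ℝ) (hM : M.PosDef) (hK : K.PosDef)
    (D R : Fin q → Fin q → Matrix (Fin n) (Fin n) ℝ)
    (hD : ∀ i j, (D i j).PosSemidef) (hDsymm : ∀ i j, D i j = D j i) (hDdiag : ∀ i, D i i = 0)
    (hR : ∀ i j, (R i j).PosSemidef) (hRsymm : ∀ i j, R i j = R j i) (hRdiag : ∀ i, R i i = 0) :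
    (∀ (hnq : n < Fintype.card (Fin q × Fin n)) (lam : Fin (Fintype.card (Fin q × Fin n)) → ℂ),
      IsEigenvalueOrdering (matGamma M K D R) lam →
      (Synchronizes M K D R ↔ 0 < (lam ⟨n, hnq⟩).re)) ∧
    (Synchronizes M K D R ↔ imagAxisCount (matGamma M K D R) = n) := by
  have hsync := synchronizes_iff_imagAxisCount_eq hq hM hK hD hDsymm hDdiag hR hRsymm hRdiag
  have hre := posSemidef_matGamma_add_conjTranspose hM hK hD hDsymm hDdiag hR hRsymm hRdiag
  have hcount := le_imagAxisCount_matGamma hq hM hK hD hDsymm hDdiag hR hRsymm hRdiag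
  exact ⟨fun hnq lam hlam => hsync.trans <|
    imagAxisCount_eq_iff_re_pos hlam (fun z => re_nonneg_of_mem_roots_charpoly hre) hnq hcount,
    hsync⟩

theorem mainTheorem1 (n q : ℕ) (hn : 1 ≤ n) (hq : 1 ≤ q)
    (M K : Matrix (Fin n) (Fin n) ℝ) (hM : M.PosDef) (hK : K.PosDef)
    (D R : Fin q → Fin q → Matrix (Fin n) (Fin n) ℝ)
    (hD : ∀ i j, (D i j).PosSemidef) (hDsymm : ∀ i j, D i j = D j i) (hDdiag : ∀ i, D i i = 0)
    (hR : ∀ i j, (R i j).PosSemidef) (hRsymm : ∀ i j, R i j = R j i) (hRdiag : ∀ i, R i i = 0)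
    (hdistinct : (SmallOscillations.matP M K).charpoly.roots.Nodup) :
    (∀ (hq2 : 2 ≤ q) (lam : Fin (Fintype.card (Fin q × Fin n)) → ℂ),
      SmallOscillations.IsEigenvalueOrdering (SmallOscillations.matGamma M K D R) lam →
      (SmallOscillations.Synchronizes M K D R ↔
        0 < (lam ⟨n, SmallOscillations.lt_card_prod hn hq2⟩).re)) ∧
    (SmallOscillations.Synchronizes M K D R ↔
      SmallOscillations.imagAxisCount (SmallOscillations.matGamma M K D R) = n) :=
  have h := mainTheorem1_general n q hq M K hM hK D R hD hDsymm hDdiag hR hRsymm hRdiag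
  ⟨fun hq2 => h.1 (SmallOscillations.lt_card_prod hn hq2), h.2⟩
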